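/- Let $\mathbb F_q$ be a finite field and $0<\bar k<\bar n$. A (time-invariant, linear) $(\bar n,\bar k,\bar m)$ convolutional code is given by matrices $G_0,\dots,G_{\bar m}\in\mathbb F_q^{\bar k\times\bar n}$; it maps a source stream $s[0],s[1],\dots\in\mathbb F_q^{\bar k}$ (with $s[i]=0$ for $i<0$) to $x[i]=\sum_{j=0}^{\bar m}s[i-j]\,G_j\in\mathbb F_q^{\bar n}$. Its rate is $R=\bar k/\bar n$. With $G_j=0$ for $j>\bar m$, the first $T+1$ outputs are $[x[0],\dots,x[T]]=[s[0],\dots,s[T]]\,G_T^s$, where $G_T^s$ is the block upper triangular matrix with block $G_{b-a}$ in block row $a$ and block column $b$ ($0\le a\le b\le T$). The column distance $d_T$ is the minimum, over all $s[0],\dots,s[T]$ with $s[0]\ne0$, of the number of indices $i\in\{0,\dots,T\}$ with $x[i]\neq 0$. The column span $c_T$ is the minimum, over the same inputs, of $j-i+1$, where $j$ is the last and $i$ the first index in $\{0,\dots,T\}$ at which $x$ is non-zero (this span is $0$ if $x[0]=\dots=x[T]=0$). (a) For every finite field, every $(\bar n,\bar k,\bar m)$ convolutional code over it with $0<\bar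 k<\bar n$, and every integer $T>0$, $$\frac{R}{1-R}\,c_T+d_T\le T+1+\frac1{1-R}.$$ (b) Conversely, for every integer $T>0$ and all integers $1\le N\le B\le T$ there are $\bar n,\bar k,\bar m$ with $0<\bar k<\bar n$ whose rate $R=\bar k/\bar n$ satisfies $\frac{R}{1-R}B+N>T$, and a number $q_0$, such that over every finite field with at least $q_0$ elements there is an $(\bar n,\bar k,\bar m)$ convolutional code with $d_T\ge N+1$, $c_T\ge B+1$ and $$\frac{R}{1-R}\,c_T+d_T\ge T+\frac1{1-R}.$$ -/

import Mathlib

open scoped Matrix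

noncomputable section

/-- A time-invariant linear `(n, k, m)` convolutional code over `F`: the generator matrices
`G 0, …, G m`, each of size `k × n`. -/
structure ConvolutionalCode (F : Type*) (n k m : ℕ) where
  /-- the generator matrices -/
  G : Fin (m + 1) → Matrix (Fin k) (Fin n) F

namespace ConvolutionalCode

variable {F : Type*} [Field F] {n k m : ℕ}

/-- The generator matrix `G_j`, which is zero for `j > m`. -/
def coeff (C : ConvolutionalCode F n k m) (j : ℕ) : Matrix (Fin k) (Fin n) F :=
  if h : j < m + 1 then C.G ⟨j, h⟩ else 0

/-- The encoder `x[i] = ∑_{j=0}^{m} s[i-j] G_j`; source symbols at negative times are zero. -/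
def encode (C : ConvolutionalCode F n k m) (s : ℕ → Fin k → F) (i : ℕ) : Fin n → F :=
  ∑ j : Fin (m + 1), if (j : ℕ) ≤ i then s (i - j) ᵥ* C.G j else 0

/-- The truncated generator matrix: block upper triangular and block Toeplitz, with
block `G_{b-a}` in block row `a` and block column `b` (`0 ≤ a ≤ b ≤ T`). -/
def truncGen (C : ConvolutionalCode F n k m) (T : ℕ) :
    Matrix (Fin (T + 1) × Fin k) (Fin (T + 1) × Fin n) F :=
  Matrix.of fun a b => if (a.1 : ℕ) ≤ (b.1 : ℕ) then C.coeff ((b.1 : ℕ) - (a.1 : ℕ)) a.2 b.2 else 0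

/-- The first `T + 1` channel symbols `[x[0], …, x[T]] = [s[0], …, s[T]] · G^s_T`. -/
def truncOutput (C : ConvolutionalCode F n k m) (T : ℕ) (s : Fin (T + 1) → Fin k → F) :
    Fin (T + 1) → Fin n → F :=
  fun i q => ((fun a : Fin (T + 1) × Fin k => s a.1 a.2) ᵥ* C.truncGen T) (i, q)

/-- The truncated generator matrix describes the first `T + 1` outputs of the encoder. -/
theorem truncOutput_eq_encode (C : ConvolutionalCode F n k m) (T : ℕ) (s : ℕ → Fin k → F)
    (i : Fin (T + 1)) : C.truncOutput T (fun a => s a) i = C.encode s i := by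
  have key : ∀ q : Fin n, ∀ d ∈ Finset.range ((i : ℕ) + 1),
      d ∉ (Finset.range ((i : ℕ) + 1)).filter (· < m + 1) →
        (s ((i : ℕ) - d) ᵥ* C.coeff d) q = 0 := by
    intro q d hd hd'
    have : ¬ d < m + 1 := fun h => hd' (Finset.mem_filter.2 ⟨hd, h⟩)
    simp [coeff, this]
  funext q
  have hL : C.truncOutput T (fun a => s a) i q
      = ∑ d ∈ Finset.range ((i : ℕ) + 1), (s ((i : ℕ) - d) ᵥ* C.coeff d) q := by
    rw [← Finset.sum_range_reflect]
    simp only [truncOutput, Matrix.vecMul, dotProduct, truncGen, Matrix.of_apply, Fintype.sum_prod_type]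
    rw [Fin.sum_univ_eq_sum_range (fun a => ∑ p : Fin k, s a p *
      (if a ≤ (i : ℕ) then C.coeff ((i : ℕ) - a) p q else 0)) (T + 1)]
    have hsub : Finset.range ((i : ℕ) + 1) ⊆ Finset.range (T + 1) :=
      Finset.range_subset_range.2 i.2
    rw [← Finset.sum_subset hsub]
    · refine Finset.sum_congr rfl fun a ha => ?_
      have ha' : a ≤ (i : ℕ) := Nat.lt_succ_iff.1 (Finset.mem_range.1 ha)
      have h2 : (i : ℕ) - ((i : ℕ) - a) = a := by omega
      simp [ha', h2]
    · intro a _ ha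
      have ha' : ¬ a ≤ (i : ℕ) := fun h => ha (Finset.mem_range.2 (Nat.lt_succ_of_le h))
      simp [ha']
  have hR : C.encode s i q
      = ∑ d ∈ (Finset.range (m + 1)).filter (· ≤ (i : ℕ)), (s ((i : ℕ) - d) ᵥ* C.coeff d) q := by
    rw [Finset.sum_filter, ← Fin.sum_univ_eq_sum_range (fun d => if d ≤ (i : ℕ) then
      (s ((i : ℕ) - d) ᵥ* C.coeff d) q else 0) (m + 1), encode, Finset.sum_apply]
    refine Finset.sum_congr rfl fun j _ => ?_
    by_cases h : (j : ℕ) ≤ (i : ℕ)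
    · simp [h, coeff, j.2]
    · simp [h]
  rw [hL, hR, ← Finset.sum_subset (Finset.filter_subset (· < m + 1) _) (key q)]
  refine Finset.sum_congr ?_ fun _ _ => rfl
  ext d
  simp only [Finset.mem_filter, Finset.mem_range]
  omega

end ConvolutionalCode

open Classical in
/-- The Hamming weight of `[x[0], …, x[T]]`: the number of indices `i` with `x[i] ≠ 0`,
each `x[i]` being a whole vector. -/
def symbolWeight {F : Type*} [Field F] {n T : ℕ} (x : Fin (T + 1) → Fin n → F) : ℕ :=
  hammingNorm x

open Classical in
/-- The span of `[x[0], …, x[T]]`: `j - i + 1` where `j` is the last and `i` the first index at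
which `x` is non-zero; it is `0` for the zero sequence. -/
def symbolSpan {F : Type*} [Field F] {n T : ℕ} (x : Fin (T + 1) → Fin n → F) : ℕ :=
  if h : (Finset.univ.filter fun i => x i ≠ 0).Nonempty then
    ((Finset.univ.filter fun i => x i ≠ 0).max' h : ℕ)
      - ((Finset.univ.filter fun i => x i ≠ 0).min' h : ℕ) + 1
  else 0

namespace ConvolutionalCode

variable {F : Type*} [Field F] {n k m : ℕ}

/-- The column distance `d_T`: the least weight of `[x[0], …, x[T]]` over all inputs
`[s[0], …, s[T]]` with `s[0] ≠ 0`. -/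
def columnDistance (C : ConvolutionalCode F n k m) (T : ℕ) : ℕ :=
  sInf ((fun s => symbolWeight (C.truncOutput T s)) '' {s : Fin (T + 1) → Fin k → F | s 0 ≠ 0})

/-- The column span `c_T`: the least span of `[x[0], …, x[T]]` over all inputs
`[s[0], …, s[T]]` with `s[0] ≠ 0`. -/
def columnSpan (C : ConvolutionalCode F n k m) (T : ℕ) : ℕ :=
  sInf ((fun s => symbolSpan (C.truncOutput T s)) '' {s : Fin (T + 1) → Fin k → F | s 0 ≠ 0})

end ConvolutionalCode

/-- The rate `R = k / n` of an `(n, k, m)` convolutional code. -/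
def codeRate (n k : ℕ) : ℝ := (k : ℝ) / (n : ℝ)

end

/-! Upper bound: put `d_T = N + 1` and `c_T = B + 1`. Whatever erasures a window of `T + 1` symbols
suffers, its first source symbol is determined, given the past, if they lie in a burst of length `B`
or number at most `N`. A channel of period `P = B + (T + 1 - N)` that erases the first `B` symbols
of each period shows every such window one of these patterns (`eq_zero_of_periodic_erasure`). So the
source is recovered from `T + 1 - N` symbols per period, and counting dimensions over many periods
gives `k P ≤ n (T + 1 - N)` (`mul_columnSpan_bound`), which rearranges to (a).

Construction: with `K = T - B` and `M = T + 1 - N`, split the source into an urgent part of `B M`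
and a non-urgent part of `K M` components. Diagonally interleaved MDS codes protect them: `M` codes
with `K` message symbols and `B` parities for the non-urgent part, `B` codes with `M` message
symbols and `N` parities for the urgent part. The urgent part is also added, with delay `T`, to the
non-urgent parities. After a burst the non-urgent codes recover, and the sum at time `T` then
reveals the urgent part; against scattered erasures each code works alone. Here `k = T M` and `n - k
= B (T + 1)`. -/

open scoped Matrix

noncomputable section

/-! ### Weight and span of a finite sequence -/

section SpanWeight

variable {F : Type*} [Field F] {n T : ℕ}

theorem symbolWeight_le_card (x : Fin (T + 1) → Fin n → F) (S : Finset ℕ)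
    (h : ∀ i : Fin (T + 1), x i ≠ 0 → (i : ℕ) ∈ S) : symbolWeight x ≤ S.card := by
  classical
  unfold symbolWeight hammingNorm
  refine Finset.card_le_card_of_injOn (fun i => (i : ℕ)) ?_ ?_
  · intro i hi
    exact h i (by simpa using hi)
  · intro a _ b _ hab
    exact Fin.ext hab

theorem symbolSpan_le_of_window (x : Fin (T + 1) → Fin n → F) (a b : ℕ)
    (h : ∀ i : Fin (T + 1), x i ≠ 0 → a ≤ (i : ℕ) ∧ (i : ℕ) < a + b) : symbolSpan x ≤ b := by
  classical
  unfold symbolSpan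
  split_ifs with hne
  · have h1 := h _ (Finset.mem_filter.1 (Finset.max'_mem _ hne)).2
    have h2 := h _ (Finset.mem_filter.1 (Finset.min'_mem _ hne)).2
    omega
  · exact Nat.zero_le _

theorem lt_symbolSpan {x : Fin (T + 1) → Fin n → F} {i j : Fin (T + 1)} (hi : x i ≠ 0)
    (hj : x j ≠ 0) : (j : ℕ) - (i : ℕ) < symbolSpan x := by
  classical
  unfold symbolSpan
  have hne : (Finset.univ.filter fun i => x i ≠ 0).Nonempty := ⟨i, by simpa using hi⟩
  rw [dif_pos hne]
  have h1 : j ≤ _ := Finset.le_max' (Finset.univ.filter fun i => x i ≠ 0) j (by simpa using hj)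
  have h2 : _ ≤ i := Finset.min'_le (Finset.univ.filter fun i => x i ≠ 0) i (by simpa using hi)
  have h1' := Fin.le_def.1 h1
  have h2' := Fin.le_def.1 h2
  omega

theorem symbolWeight_le_symbolSpan (x : Fin (T + 1) → Fin n → F) :
    symbolWeight x ≤ symbolSpan x := by
  classical
  by_cases hne : (Finset.univ.filter fun i => x i ≠ 0).Nonempty
  · set S := Finset.univ.filter fun i => x i ≠ 0 with hS
    have hmin := (Finset.mem_filter.1 (S.min'_mem hne)).2
    have h := symbolWeight_le_card x
      (Finset.Ico (S.min' hne : ℕ) ((S.min' hne : ℕ) + symbolSpan x)) ?_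
    · simpa using h
    · intro i hi
      have h1 := Fin.le_def.1 (S.min'_le i (by simpa [hS] using hi))
      have h2 := lt_symbolSpan hmin hi
      rw [Finset.mem_Ico]
      omega
  · have h := symbolWeight_le_card x ∅ fun i hi => (hne ⟨i, by simpa using hi⟩).elim
    simpa using h.trans (Nat.zero_le _)

end SpanWeight

/-! ### The upper bound, by periodic erasures -/

namespace ConvolutionalCode

variable {F : Type*} [Field F] {n k m : ℕ}

theorem columnDistance_le (C : ConvolutionalCode F n k m) {T : ℕ} {s : ℕ → Fin k → F}
    (hs : s 0 ≠ 0) :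
    C.columnDistance T ≤ symbolWeight fun i : Fin (T + 1) => C.encode s i := by
  refine Nat.sInf_le ⟨fun a => s a, by simpa using hs, ?_⟩
  exact congrArg symbolWeight (funext fun i => C.truncOutput_eq_encode T s i)

theorem columnSpan_le (C : ConvolutionalCode F n k m) {T : ℕ} {s : ℕ → Fin k → F}
    (hs : s 0 ≠ 0) :
    C.columnSpan T ≤ symbolSpan fun i : Fin (T + 1) => C.encode s i := by
  refine Nat.sInf_le ⟨fun a => s a, by simpa using hs, ?_⟩
  exact congrArg symbolSpan (funext fun i => C.truncOutput_eq_encode T s i)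

theorem nonempty_inputs (hk : 0 < k) (T : ℕ) :
    {s : Fin (T + 1) → Fin k → F | s 0 ≠ 0}.Nonempty :=
  ⟨fun _ _ => 1, fun h => one_ne_zero (congrFun h ⟨0, hk⟩)⟩

theorem exists_symbolSpan_eq (C : ConvolutionalCode F n k m) (hk : 0 < k) (T : ℕ) :
    ∃ s : Fin (T + 1) → Fin k → F, s 0 ≠ 0 ∧ symbolSpan (C.truncOutput T s) = C.columnSpan T :=
  Nat.sInf_mem ((nonempty_inputs hk T).image fun s => symbolSpan (C.truncOutput T s))

theorem columnDistance_le_columnSpan (C : ConvolutionalCode F n k m) (hk : 0 < k) (T : ℕ) :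
    C.columnDistance T ≤ C.columnSpan T := by
  obtain ⟨s, hs, h⟩ := C.exists_symbolSpan_eq hk T
  rw [← h]
  have hle : C.columnDistance T ≤ symbolWeight (C.truncOutput T s) := Nat.sInf_le ⟨s, hs, rfl⟩
  exact hle.trans (symbolWeight_le_symbolSpan _)

theorem columnSpan_le_succ (C : ConvolutionalCode F n k m) (hk : 0 < k) (T : ℕ) :
    C.columnSpan T ≤ T + 1 := by
  obtain ⟨s, hs, h⟩ := C.exists_symbolSpan_eq hk T
  rw [← h]
  exact symbolSpan_le_of_window _ 0 _ fun i _ => by omega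

theorem columnDistance_pos (C : ConvolutionalCode F n k m) (hk : 0 < k) {T : ℕ}
    (h : 0 < C.columnSpan T) : 0 < C.columnDistance T := by
  classical
  obtain ⟨s, hs, hd⟩ : ∃ s : Fin (T + 1) → Fin k → F, s 0 ≠ 0 ∧
      symbolWeight (C.truncOutput T s) = C.columnDistance T :=
    Nat.sInf_mem ((nonempty_inputs hk T).image fun s => symbolWeight (C.truncOutput T s))
  by_contra h0
  have hz : symbolWeight (C.truncOutput T s) = 0 := by omega
  have hx : C.truncOutput T s = 0 := hammingNorm_eq_zero.1 hz
  have hle : C.columnSpan T ≤ symbolSpan (C.truncOutput T s) := Nat.sInf_le ⟨s, hs, rfl⟩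
  have := symbolSpan_le_of_window (C.truncOutput T s) 0 0 fun i hi => (hi (by simp [hx])).elim
  omega

/-- Time invariance: an input that vanishes before time `i` is encoded as its shift. -/
theorem encode_add (C : ConvolutionalCode F n k m) (s : ℕ → Fin k → F) (i t : ℕ)
    (h : ∀ j < i, s j = 0) : C.encode s (i + t) = C.encode (fun a => s (i + a)) t := by
  unfold encode
  refine Finset.sum_congr rfl fun j _ => ?_
  by_cases h1 : (j : ℕ) ≤ t
  · rw [if_pos h1, if_pos (by omega), show i + t - (j : ℕ) = i + (t - j) by omega]
  · rw [if_neg h1]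
    split_ifs with h2
    · rw [h _ (by omega), Matrix.zero_vecMul]
    · rfl

/-- Decoding over the periodic erasure channel that erases the first `B` of every
`B + (T + 1 - N)` symbols. -/
theorem eq_zero_of_periodic_erasure (C : ConvolutionalCode F n k m) {T N B : ℕ}
    (hNB : N ≤ B) (hBT : B ≤ T) (hd : N < C.columnDistance T) (hc : B < C.columnSpan T)
    (s : ℕ → Fin k → F) (M : ℕ)
    (hx : ∀ i < M + T, B ≤ i % (B + (T + 1 - N)) → C.encode s i = 0) :
    ∀ i < M, s i = 0 := by
  set P := B + (T + 1 - N) with hP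
  intro i
  induction i using Nat.strong_induction_on with
  | _ i ih =>
    intro hi
    by_contra hs
    have hprev : ∀ j < i, s j = 0 := fun j hj => ih j hj (hj.trans hi)
    have hs0 : (fun a => s (i + a)) 0 ≠ 0 := by simpa using hs
    have hD := C.columnDistance_le (T := T) (s := fun a => s (i + a)) hs0
    have hC := C.columnSpan_le (T := T) (s := fun a => s (i + a)) hs0
    have hPpos : 0 < P := by omega
    have hr := Nat.mod_lt i hPpos
    have hdiv := Nat.div_add_mod i P
    have hsupp : ∀ t : Fin (T + 1), C.encode (fun a => s (i + a)) t ≠ 0 →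
        (i % P + t) % P < B := by
      intro t ht
      rw [← C.encode_add s i t hprev] at ht
      by_contra hB
      refine ht (hx _ (by omega) ?_)
      rw [Nat.mod_add_mod] at hB
      omega
    have hred : ∀ t, i % P + t < P → (i % P + t) % P = i % P + t := fun t => Nat.mod_eq_of_lt
    have hred' : ∀ t, P ≤ i % P + t → i % P + t < 2 * P →
        (i % P + t) % P = i % P + t - P := fun t h1 h2 => by
      rw [Nat.mod_eq_sub_mod h1, Nat.mod_eq_of_lt (by omega)]
    generalize i % P = r at *
    -- As `N ≤ B`, the period is at least `T + 1`, so the window wraps around it at most once. If it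
    -- starts at an unerased time, it meets a single burst.
    by_cases h1 : B ≤ r
    · have := symbolSpan_le_of_window _ (P - r) B fun t ht => by
        have h2 := hsupp t ht
        have ht' := t.2
        by_cases h3 : r + t < P
        · rw [hred t h3] at h2; omega
        · rw [hred' t (by omega) (by omega)] at h2
          omega
      omega
    -- The window starts inside a burst. If it ends before the next one, only the rest of this burst
    -- is erased.
    · by_cases h2 : r + T < P
      · have := symbolSpan_le_of_window _ 0 B fun t ht => by
          have h2 := hsupp t ht
          have ht' := t.2
          rw [hred t (by omega)] at h2
          omega
        omega
      -- The window meets two bursts, in `(B - r) + (T + 1 - P + r) = N` symbols; the period is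
      -- chosen for this equality.
      · have := symbolWeight_le_card _ (Finset.range (B - r) ∪ Finset.Ico (P - r) (T + 1))
          fun t ht => by
            have h2 := hsupp t ht
            have ht' := t.2
            simp only [Finset.mem_union, Finset.mem_range, Finset.mem_Ico]
            by_cases h3 : r + t < P
            · rw [hred t h3] at h2; omega
            · omega
        have hcard := Finset.card_union_le (Finset.range (B - r)) (Finset.Ico (P - r) (T + 1))
        simp only [Finset.card_range, Nat.card_Ico] at hcard
        omega

/-- The encoder as a linear map from inputs supported on `[0, M)` to the outputs at the
times in `S`. -/
def encodeOn (C : ConvolutionalCode F n k m) (M : ℕ) (S : Finset ℕ) :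
    (Fin M → Fin k → F) →ₗ[F] (S → Fin n → F) where
  toFun s i := C.encode (fun a => if h : a < M then s ⟨a, h⟩ else 0) i
  map_add' s t := by
    funext i
    simp only [encode, Pi.add_apply, ← Finset.sum_add_distrib]
    refine Finset.sum_congr rfl fun j _ => ?_
    split_ifs <;> simp [Matrix.add_vecMul]
  map_smul' c s := by
    funext i
    simp only [encode, Pi.smul_apply, RingHom.id_apply, Finset.smul_sum]
    refine Finset.sum_congr rfl fun j _ => ?_
    split_ifs <;> simp [Matrix.smul_vecMul]

theorem card_filter_mod_le (P B T L : ℕ) (hB : B ≤ P) :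
    ((Finset.range (L * P + T)).filter fun i => B ≤ i % P).card ≤ L * (P - B) + T := by
  induction L with
  | zero =>
    simpa using Finset.card_filter_le (Finset.range T) fun i => B ≤ i % P
  | succ L ih =>
    rcases Nat.eq_zero_or_pos P with rfl | hP
    · simpa using Finset.card_filter_le (Finset.range T) fun i => B ≤ i % 0
    have hsub : (Finset.range ((L + 1) * P + T)).filter (fun i => B ≤ i % P) ⊆
        Finset.Ico B P ∪ ((Finset.range (L * P + T)).filter fun i => B ≤ i % P).map
          (addRightEmbedding P) := by
      intro i hi
      simp only [Finset.mem_filter, Finset.mem_range, Finset.mem_union, Finset.mem_Ico,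
        Finset.mem_map, addRightEmbedding_apply] at hi ⊢
      by_cases h : i < P
      · left
        rw [Nat.mod_eq_of_lt h] at hi
        exact ⟨hi.2, h⟩
      · right
        refine ⟨i - P, ⟨?_, ?_⟩, by omega⟩
        · have := hi.1
          rw [add_mul] at this
          omega
        · rw [← Nat.mod_eq_sub_mod (by omega)]
          exact hi.2
    have h1 := (Finset.card_le_card hsub).trans (Finset.card_union_le _ _)
    rw [Finset.card_map, Nat.card_Ico] at h1
    rw [Nat.succ_mul L (P - B)]
    omega

/-- Inputs of length `L * P` are determined by the unerased outputs before time `L * P + T`, so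
`encodeOn` is injective and dimensions can be compared. The tail of `T` outputs is negligible for
large `L`. -/
theorem mul_columnSpan_bound (C : ConvolutionalCode F n k m) {T N B : ℕ}
    (hNB : N ≤ B) (hBT : B ≤ T) (hd : N < C.columnDistance T) (hc : B < C.columnSpan T) :
    k * (B + (T + 1 - N)) ≤ n * (T + 1 - N) := by
  set P := B + (T + 1 - N) with hP
  have key : ∀ L : ℕ, k * (L * P) ≤ n * (L * (T + 1 - N) + T) := by
    intro L
    set S := (Finset.range (L * P + T)).filter fun i => B ≤ i % P with hS
    have hinj : Function.Injective (C.encodeOn (L * P) S) := by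
      rw [injective_iff_map_eq_zero]
      intro s hs
      have h0 := C.eq_zero_of_periodic_erasure hNB hBT hd hc
        (fun a => if h : a < L * P then s ⟨a, h⟩ else 0) (L * P) (fun i hi hB =>
          congrFun hs ⟨i, Finset.mem_filter.2 ⟨Finset.mem_range.2 hi, hB⟩⟩)
      funext a
      simpa using h0 a a.2
    have h1 := LinearMap.finrank_le_finrank_of_injective hinj
    simp only [Module.finrank_pi_fintype, Module.finrank_self, Finset.sum_const, Finset.card_univ,
      Fintype.card_fin, Fintype.card_coe, smul_eq_mul, mul_one] at h1
    have h2 := card_filter_mod_le P B T L (by omega)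
    rw [show P - B = T + 1 - N by omega] at h2
    calc k * (L * P) = L * P * k := mul_comm _ _
      _ ≤ S.card * n := h1
      _ ≤ (L * (T + 1 - N) + T) * n := Nat.mul_le_mul_right _ h2
      _ = _ := mul_comm _ _
  by_contra hlt
  -- A deficit of at least one per period, over more than `n * T` periods, outweighs the tail.
  have h := key (n * T + 1)
  have h2 : (n * T + 1) * (n * (T + 1 - N) + 1) ≤ (n * T + 1) * (k * P) :=
    Nat.mul_le_mul_left _ (by omega)
  nlinarith

theorem rate_mul_columnSpan_add_columnDistance_le (C : ConvolutionalCode F n k m) (hk : 0 < k)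
    (hkn : k < n) (T : ℕ) :
    codeRate n k / (1 - codeRate n k) * (C.columnSpan T : ℝ) + (C.columnDistance T : ℝ)
      ≤ (T : ℝ) + 1 + 1 / (1 - codeRate n k) := by
  have hn : (0 : ℝ) < n := by exact_mod_cast hk.trans hkn
  have hk' : (k : ℝ) < n := by exact_mod_cast hkn
  have hnk : (0 : ℝ) < n - k := by linarith
  have h1R : 1 - codeRate n k = (n - k) / n := by
    unfold codeRate; field_simp
  have hR : codeRate n k / (1 - codeRate n k) = k / (n - k) := by
    rw [h1R]; unfold codeRate; field_simp
  have hR' : 1 / (1 - codeRate n k) = n / (n - k) := by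
    rw [h1R]; field_simp
  rw [hR, hR']
  have hdc := C.columnDistance_le_columnSpan hk T
  have hcT := C.columnSpan_le_succ hk T
  -- A zero span leaves no `B` with `c_T = B + 1`, but then the left side is zero.
  rcases Nat.eq_zero_or_pos (C.columnSpan T) with h0 | hpos
  · have hd0 : C.columnDistance T = 0 := by omega
    rw [h0, hd0]
    simp only [Nat.cast_zero, mul_zero, add_zero]
    positivity
  · have hdpos := C.columnDistance_pos hk hpos
    obtain ⟨N, hN⟩ : ∃ N, C.columnDistance T = N + 1 := ⟨_, (Nat.sub_add_cancel hdpos).symm⟩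
    obtain ⟨B, hB⟩ : ∃ B, C.columnSpan T = B + 1 := ⟨_, (Nat.sub_add_cancel hpos).symm⟩
    have h := C.mul_columnSpan_bound (T := T) (N := N) (B := B) (by omega) (by omega) (by omega)
      (by omega)
    have h' : (k : ℝ) * (B + (T + 1 - N)) ≤ n * (T + 1 - N) := by
      have := (Nat.cast_le (α := ℝ)).2 h
      push_cast [Nat.cast_sub (show N ≤ T + 1 by omega)] at this
      exact this
    rw [hN, hB, ← sub_nonneg]
    push_cast
    have : (T : ℝ) + 1 + n / (n - k) - (k / (n - k) * (B + 1) + (N + 1))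
        = (n * (T + 1 - N) - k * (B + (T + 1 - N))) / (n - k) := by
      field_simp; ring
    rw [this]
    exact div_nonneg (by linarith) hnk.le

end ConvolutionalCode

/-! ### MDS block codes -/

section BlockCode

variable {F : Type*} [Field F]

/-- The systematic block code with parity matrix `A` has minimum distance greater than the number
of its parities: a codeword that is supported on a set `S` of at most `D` positions is zero. The
message occupies the positions `0, …, k - 1`, the parities the positions `k, …, k + D - 1`. -/
def IsMDSParity {k D : ℕ} (A : Matrix (Fin k) (Fin D) F) : Prop :=
  ∀ (w : Fin k → F) (S : Finset ℕ), S.card ≤ D → (∀ l : Fin k, (l : ℕ) ∉ S → w l = 0) →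
    (∀ j : Fin D, k + (j : ℕ) ∉ S → (w ᵥ* A) j = 0) → w = 0

/-- Systematic Reed–Solomon codes. -/
theorem exists_isMDSParity [Finite F] (k D : ℕ) (h : k + D ≤ Nat.card F) :
    ∃ A : Matrix (Fin k) (Fin D) F, IsMDSParity A := by
  classical
  have := Fintype.ofFinite F
  obtain ⟨e⟩ : Nonempty (Fin (k + D) ↪ F) := Function.Embedding.nonempty_of_card_le (by
    rwa [Fintype.card_fin, ← Nat.card_eq_fintype_card])
  set a : Fin k → F := fun l => e (Fin.castAdd D l) with ha
  have hainj : Set.InjOn a (Finset.univ : Finset (Fin k)) := fun x _ y _ hxy =>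
    Fin.castAdd_injective k D (e.injective hxy)
  refine ⟨Matrix.of fun l j => (Lagrange.basis Finset.univ a l).eval (e (Fin.natAdd k j)), ?_⟩
  intro w S hS hw hq
  set f := Lagrange.interpolate Finset.univ a w with hf
  have hmsg : ∀ l, f.eval (a l) = w l := fun l =>
    Lagrange.eval_interpolate_at_node w hainj (Finset.mem_univ l)
  have hpar : ∀ j : Fin D, f.eval (e (Fin.natAdd k j)) = (w ᵥ* Matrix.of fun l j =>
      (Lagrange.basis Finset.univ a l).eval (e (Fin.natAdd k j))) j := by
    intro j
    simp [hf, Lagrange.interpolate_apply, Polynomial.eval_finsetSum, Matrix.vecMul, dotProduct]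
  set Z : Finset (Fin (k + D)) := Finset.univ.filter fun p => (p : ℕ) ∉ S with hZ
  -- The interpolating polynomial has degree below `k` and vanishes at every position outside `S`,
  -- of which there are at least `k`.
  have hcard : k ≤ Z.card := by
    have h1 : (Finset.univ.filter fun p : Fin (k + D) => (p : ℕ) ∈ S).card + Z.card =
        (Finset.univ : Finset (Fin (k + D))).card := by
      rw [hZ]
      convert Finset.card_filter_add_card_filter_not (s := (Finset.univ : Finset (Fin (k + D))))
        (fun p => (p : ℕ) ∈ S)
    have h2 : (Finset.univ.filter fun p : Fin (k + D) => (p : ℕ) ∈ S).card ≤ S.card :=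
      Finset.card_le_card_of_injOn (fun p => (p : ℕ)) (fun p hp => by simpa using hp)
        fun x _ y _ hxy => Fin.ext hxy
    rw [Finset.card_univ, Fintype.card_fin] at h1
    omega
  have hf0 : f = 0 := by
    refine Polynomial.eq_zero_of_degree_lt_of_eval_index_eq_zero Z (v := e) e.injective.injOn ?_ ?_
    · refine (Lagrange.degree_interpolate_lt w hainj).trans_le ?_
      rw [Finset.card_univ, Fintype.card_fin]
      exact_mod_cast hcard
    · intro p hp
      have hp' : (p : ℕ) ∉ S := by simpa [hZ] using hp
      induction p using Fin.addCases with
      | left l => exact (hmsg l).trans (hw l hp')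
      | right j => exact (hpar j).trans (hq j hp')
  funext l
  rw [← hmsg l, hf0, Polynomial.eval_zero, Pi.zero_apply]

end BlockCode

/-! ### The code attaining part (b) -/

namespace StreamingCode

/-- Source components: an urgent part, and a non-urgent part. -/
abbrev Src (B K M : ℕ) : Type := (Fin B × Fin M) ⊕ (Fin K × Fin M)

/-- Channel components: the source, burst parities combined with the delayed urgent part, and
parities of the urgent part. -/
abbrev Chan (B K M N : ℕ) : Type := Src B K M ⊕ ((Fin B × Fin M) ⊕ (Fin B × Fin N))

variable {F : Type*} [Field F] {B K M N : ℕ}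

/-- The coefficient, at delay `d`, of a source component in a channel component. Both block codes
are interleaved diagonally; the urgent part is repeated with delay `K + B`. -/
def gen (Av : Matrix (Fin K) (Fin B) F) (Au : Matrix (Fin M) (Fin N) F) (d : ℕ) :
    Src B K M → Chan B K M N → F
  | a, .inl b => if d = 0 ∧ a = b then 1 else 0
  | .inl (j, c), .inr (.inl (j', c')) => if d = K + B ∧ j = j' ∧ c = c' then 1 else 0
  | .inr (l, c), .inr (.inl (j, c')) => if d + l = K + j ∧ c = c' then Av l j else 0
  | .inl (j, c), .inr (.inr (j', r)) => if d + c = M + r ∧ j = j' then Au c r else 0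
  | .inr _, .inr (.inr _) => 0

/-- The output at time `z` for a source stream indexed by the integers. -/
def out (Av : Matrix (Fin K) (Fin B) F) (Au : Matrix (Fin M) (Fin N) F)
    (s : ℤ → Src B K M → F) (z : ℤ) (o : Chan B K M N) : F :=
  ∑ d ∈ Finset.range (K + B + 1), ∑ a, s (z - d) a * gen Av Au d a o

/-- A source component enters a channel component at no more than one delay, so each convolution sum
collapses to one term. -/
theorem sum_delay {R : Type*} [NonUnitalNonAssocSemiring R] (L e : ℕ) (he : e < L) (p : ℕ → Prop)
    [DecidablePred p] (P : Prop) [Decidable P] (hp : ∀ d, p d ↔ d = e ∧ P) (f : ℕ → R) (x : R) :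
    (∑ d ∈ Finset.range L, f d * if p d then x else 0) = if P then f e * x else 0 := by
  rw [Finset.sum_eq_single_of_mem e (Finset.mem_range.2 he)]
  · simp [hp]
  · intro d _ hd
    simp [hp, hd]

variable (Av : Matrix (Fin K) (Fin B) F) (Au : Matrix (Fin M) (Fin N) F)
  (s : ℤ → Src B K M → F) (z : ℤ)

theorem out_source (a : Src B K M) : out Av Au s z (.inl a) = s z a := by
  unfold out
  rw [Finset.sum_comm]
  have h : ∀ b : Src B K M, (∑ d ∈ Finset.range (K + B + 1),
      s (z - d) b * gen Av Au d b (.inl a)) = if b = a then s z b else 0 := by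
    intro b
    simp only [gen]
    rw [sum_delay _ 0 (by omega) _ (b = a) (fun d => Iff.rfl) (fun d => s (z - d) b)]
    simp
  simp [h]

theorem out_burstParity (j : Fin B) (c : Fin M) :
    out Av Au s z (.inr (.inl (j, c))) =
      ((fun l : Fin K => s (z - (K + j) + l) (.inr (l, c))) ᵥ* Av) j
        + s (z - (K + B)) (.inl (j, c)) := by
  unfold out
  rw [Finset.sum_comm, Fintype.sum_sum_type, add_comm]
  congr 1
  · have h : ∀ b : Fin K × Fin M, (∑ d ∈ Finset.range (K + B + 1),
        s (z - d) (.inr b) * gen Av Au d (.inr b) (.inr (.inl (j, c)))) =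
          if b.2 = c then s (z - (K + j) + b.1) (.inr b) * Av b.1 j else 0 := by
      rintro ⟨l, c'⟩
      simp only [gen]
      rw [sum_delay _ (K + j - l) (by omega) _ (c' = c)
        (fun d => and_congr_left fun _ => by omega) (fun d => s (z - d) (.inr (l, c')))]
      rw [show z - ((K + j - l : ℕ) : ℤ) = z - (K + j) + l by omega]
    simp only [h, Fintype.sum_prod_type, Finset.sum_ite_eq', Finset.mem_univ, if_true,
      Matrix.vecMul, dotProduct]
  · have h : ∀ b : Fin B × Fin M, (∑ d ∈ Finset.range (K + B + 1),
        s (z - d) (.inl b) * gen Av Au d (.inl b) (.inr (.inl (j, c)))) =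
          if b = (j, c) then s (z - (K + B)) (.inl b) else 0 := by
      rintro ⟨j', c'⟩
      simp only [gen]
      rw [sum_delay _ (K + B) (by omega) _ ((j', c') = (j, c))
        (fun d => by rw [Prod.mk.injEq]) (fun d => s (z - d) (.inl (j', c')))]
      simp
    simp [h]

theorem out_urgentParity (hMN : M + N ≤ K + B + 1) (j : Fin B) (r : Fin N) :
    out Av Au s z (.inr (.inr (j, r))) =
      ((fun c : Fin M => s (z - (M + r) + c) (.inl (j, c))) ᵥ* Au) r := by
  unfold out
  rw [Finset.sum_comm, Fintype.sum_sum_type]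
  have h : ∀ b : Fin B × Fin M, (∑ d ∈ Finset.range (K + B + 1),
      s (z - d) (.inl b) * gen Av Au d (.inl b) (.inr (.inr (j, r)))) =
        if b.1 = j then s (z - (M + r) + b.2) (.inl b) * Au b.2 r else 0 := by
    rintro ⟨j', c⟩
    simp only [gen]
    rw [sum_delay _ (M + r - c) (by omega) _ (j' = j)
      (fun d => and_congr_left fun _ => by omega) (fun d => s (z - d) (.inl (j', c)))]
    rw [show z - ((M + r - c : ℕ) : ℤ) = z - (M + r) + c by omega]
  simp only [h, Fintype.sum_prod_type_right, Finset.sum_ite_eq', Finset.mem_univ, if_true,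
    Matrix.vecMul, dotProduct]
  simp [gen]

variable {Av Au s}

/-- A non-zero initial symbol is seen after any burst of `B` erasures that starts at time `0`. -/
theorem source_eq_zero_of_burst (hAv : IsMDSParity Av) (hneg : ∀ z < 0, s z = 0)
    (h : ∀ z : ℤ, B ≤ z → z ≤ K + B → out Av Au s z = 0) : s 0 = 0 := by
  have hs : ∀ z : ℤ, B ≤ z → z ≤ K + B → ∀ a, s z a = 0 := fun z h1 h2 a => by
    rw [← out_source Av Au s z a, h z h1 h2, Pi.zero_apply]
  -- Before time `K + B` the delayed urgent summand comes from a negative time, so the parities are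
  -- clean.
  have hq : ∀ z : ℤ, B ≤ z → z < K + B → ∀ (j : Fin B) (c : Fin M),
      ((fun l : Fin K => s (z - (K + j) + l) (.inr (l, c))) ᵥ* Av) j = 0 := by
    intro z h1 h2 j c
    have h3 := out_burstParity Av Au s z j c
    rw [h z h1 h2.le, hneg (z - (K + B)) (by omega)] at h3
    simpa using h3.symm
  funext a
  rcases a with ⟨j₀, c⟩ | ⟨l₀, c⟩
  -- This diagonal has its parity `j₀` at time `K + B`. It misses `j₀` symbols in the burst and the
  -- `B - j₀` parities from time `K + B` on, `B` in all, so it vanishes and that parity equals the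
  -- urgent symbol.
  · have hw := hAv (fun l : Fin K => s ((B - j₀ : ℤ) + l) (.inr (l, c)))
      (Finset.range j₀ ∪ Finset.Ico (K + j₀) (K + B))
      ((Finset.card_union_le _ _).trans (by simp; omega)) ?_ ?_
    · have h3 := out_burstParity Av Au s (K + B) j₀ c
      rw [h _ (by omega) le_rfl] at h3
      rw [show ((K : ℤ) + B - (K + j₀)) = B - j₀ by ring, hw] at h3
      simpa using h3.symm
    · intro l hl
      simp only [Finset.mem_union, Finset.mem_range, Finset.mem_Ico] at hl
      exact hs _ (by omega) (by omega) _
    · intro j hj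
      simp only [Finset.mem_union, Finset.mem_range, Finset.mem_Ico] at hj
      have := hq (B - j₀ + (K + j)) (by omega) (by omega) j c
      rwa [show (B - j₀ + (K + j) - (K + j) : ℤ) = B - j₀ by ring] at this
  -- The diagonal through the component at time `0`; the burst hits exactly positions `l₀, …, l₀ + B
  -- - 1`.
  · have hw := hAv (fun l : Fin K => s ((-l₀ : ℤ) + l) (.inr (l, c))) (Finset.Ico l₀ (l₀ + B))
      (by simp) ?_ ?_
    · simpa using congrFun hw l₀
    · intro l hl
      simp only [Finset.mem_Ico] at hl
      by_cases h1 : (l : ℕ) < l₀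
      · rw [hneg _ (by omega), Pi.zero_apply]
      · exact hs _ (by omega) (by omega) _
    · intro j hj
      simp only [Finset.mem_Ico] at hj
      have := hq (-l₀ + (K + j)) (by omega) (by omega) j c
      rwa [show (-l₀ + (K + j) - (K + j) : ℤ) = -l₀ by ring] at this

/-- A non-zero initial symbol is seen through any `N` erasures. -/
theorem source_eq_zero_of_card_le (hAv : IsMDSParity Av) (hAu : IsMDSParity Au) (hNB : N ≤ B)
    (hMN : M + N ≤ K + B + 1) (hneg : ∀ z < 0, s z = 0) (S : Finset ℕ) (hS : S.card ≤ N)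
    (h : ∀ i : ℕ, i ≤ K + B → i ∉ S → out Av Au s i = 0) : s 0 = 0 := by
  have hs : ∀ (p q : ℕ), p ≤ K + B → p ∉ S.image (· + q) → ∀ a, s (-q + p) a = 0 := by
    intro p q hp hpS a
    by_cases h1 : p < q
    · rw [hneg _ (by omega), Pi.zero_apply]
    · have h2 : (-q + p : ℤ) = (p - q : ℕ) := by omega
      rw [h2, ← out_source Av Au s _ a, h (p - q) (by omega) ?_, Pi.zero_apply]
      exact fun h3 => hpS (Finset.mem_image.2 ⟨p - q, h3, by omega⟩)
  have ho : ∀ (p q : ℕ), q ≤ p → p ≤ K + B → p ∉ S.image (· + q) →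
      out Av Au s (-q + p) = 0 := by
    intro p q hqp hp hpS
    have h2 : (-q + p : ℤ) = (p - q : ℕ) := by omega
    rw [h2]
    exact h (p - q) (by omega) fun h3 => hpS (Finset.mem_image.2 ⟨p - q, h3, by omega⟩)
  funext a
  rcases a with ⟨j, c₀⟩ | ⟨l₀, c⟩
  -- The diagonal through the component starts at time `-c₀` and ends by time `K + B` because `M + N
  -- ≤ K + B + 1`; entries at negative times are zero, hence known.
  · have hw := hAu (fun c : Fin M => s ((-c₀ : ℤ) + c) (.inl (j, c))) (S.image (· + c₀))
      (Finset.card_image_le.trans hS) (fun c hc => hs c c₀ (by omega) hc _) ?_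
    · simpa using congrFun hw c₀
    · intro r hr
      have h1 := out_urgentParity Av Au s (-c₀ + (M + r : ℕ)) hMN j r
      rw [ho _ _ (by omega) (by omega) hr] at h1
      rw [show (-c₀ + (M + r : ℕ) - (M + r) : ℤ) = -c₀ by push_cast; ring] at h1
      exact h1.symm
  · have hw := hAv (fun l : Fin K => s ((-l₀ : ℤ) + l) (.inr (l, c))) (S.image (· + l₀))
      (Finset.card_image_le.trans (hS.trans hNB)) (fun l hl => hs l l₀ (by omega) hl _) ?_
    · simpa using congrFun hw l₀
    · intro j hj
      have h1 := out_burstParity Av Au s (-l₀ + (K + j : ℕ)) j c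
      rw [ho _ _ (by omega) (by omega) hj, hneg (_ - (K + B)) (by omega)] at h1
      rw [show (-l₀ + (K + j : ℕ) - (K + j) : ℤ) = -l₀ by push_cast; ring] at h1
      simpa using h1.symm

variable (Av Au)

/-- The streaming code, with the components numbered. -/
def code : ConvolutionalCode F (Fintype.card (Chan B K M N)) (Fintype.card (Src B K M)) (K + B) where
  G d := Matrix.of fun a b =>
    gen Av Au d ((Fintype.equivFin _).symm a) ((Fintype.equivFin _).symm b)

/-- A truncated source stream, as a stream indexed by the integers. -/
def extend {T : ℕ} (s : Fin (T + 1) → Fin (Fintype.card (Src B K M)) → F) (z : ℤ)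
    (a : Src B K M) : F :=
  if h : 0 ≤ z ∧ z.toNat < T + 1 then s ⟨z.toNat, h.2⟩ (Fintype.equivFin _ a) else 0

theorem truncOutput_code {T : ℕ} (s : Fin (T + 1) → Fin (Fintype.card (Src B K M)) → F)
    (i : Fin (T + 1)) (b : Fin (Fintype.card (Chan B K M N))) :
    (code Av Au).truncOutput T s i b =
      out Av Au (extend s) (i : ℕ) ((Fintype.equivFin _).symm b) := by
  set s' : ℕ → Fin (Fintype.card (Src B K M)) → F :=
    fun a => if h : a < T + 1 then s ⟨a, h⟩ else 0 with hs'
  have h1 : s = fun a : Fin (T + 1) => s' a := by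
    funext a
    simp only [hs']
    rw [dif_pos a.2]
  conv_lhs => rw [h1, ConvolutionalCode.truncOutput_eq_encode]
  unfold ConvolutionalCode.encode out
  rw [Finset.sum_apply, ← Fin.sum_univ_eq_sum_range
    (fun d => ∑ a, extend s ((i : ℕ) - d) a * gen Av Au d a ((Fintype.equivFin _).symm b))]
  refine Finset.sum_congr rfl fun d _ => ?_
  rw [← (Fintype.equivFin (Src B K M)).symm.sum_comp]
  by_cases hd : (d : ℕ) ≤ i
  · rw [if_pos hd]
    simp only [Matrix.vecMul, dotProduct]
    refine Finset.sum_congr rfl fun a _ => ?_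
    have h2 : (((i : ℕ) : ℤ) - (d : ℕ)) = ((i - d : ℕ) : ℤ) := by omega
    have h3 : (i : ℕ) - d < T + 1 := by omega
    have h4 : s' (i - d) = s ⟨i - d, h3⟩ := dif_pos h3
    rw [h2, h4]
    unfold extend
    rw [dif_pos ⟨by omega, by simpa using h3⟩]
    simp [code]
  · rw [if_neg hd]
    refine (Finset.sum_eq_zero fun a _ => ?_).symm
    have h2 : ¬ (0 ≤ ((i : ℕ) : ℤ) - (d : ℕ)) := by omega
    simp only [extend, h2, false_and, dite_false, zero_mul]

theorem extend_neg {T : ℕ} (s : Fin (T + 1) → Fin (Fintype.card (Src B K M)) → F) (z : ℤ)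
    (hz : z < 0) : extend s z = 0 := by
  funext a
  exact dif_neg fun h => by omega

theorem extend_zero {T : ℕ} {s : Fin (T + 1) → Fin (Fintype.card (Src B K M)) → F}
    (hs : s 0 ≠ 0) : extend s 0 ≠ 0 := by
  intro h
  refine hs (funext fun a => ?_)
  simpa [extend] using congrFun h ((Fintype.equivFin _).symm a)

theorem out_extend_eq_zero {T : ℕ} {s : Fin (T + 1) → Fin (Fintype.card (Src B K M)) → F}
    {i : Fin (T + 1)} (h : (code Av Au).truncOutput T s i = 0) :
    out Av Au (extend s) (i : ℕ) = 0 := by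
  funext o
  have := truncOutput_code Av Au s i (Fintype.equivFin _ o)
  rw [h] at this
  simpa using this.symm

variable {Av Au}

theorem lt_columnDistance_code (hAv : IsMDSParity Av) (hAu : IsMDSParity Au) (hNB : N ≤ B)
    (hMN : M + N ≤ K + B + 1) (hpos : 0 < Fintype.card (Src B K M)) :
    N + 1 ≤ (code Av Au).columnDistance (K + B) := by
  classical
  refine le_csInf ((ConvolutionalCode.nonempty_inputs hpos _).image _) ?_
  rintro _ ⟨s, hs, rfl⟩
  by_contra hlt
  refine extend_zero hs (source_eq_zero_of_card_le hAv hAu hNB hMN (extend_neg s)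
    (Finset.image (fun i : Fin (K + B + 1) => (i : ℕ))
      (Finset.univ.filter fun i => (code Av Au).truncOutput (K + B) s i ≠ 0)) ?_ ?_)
  · refine Finset.card_image_le.trans ?_
    unfold symbolWeight hammingNorm at hlt
    exact Nat.lt_succ_iff.1 (not_le.1 hlt)
  · intro i hi hiS
    refine out_extend_eq_zero Av Au (i := ⟨i, by omega⟩) ?_
    by_contra hne
    exact hiS (Finset.mem_image.2 ⟨⟨i, by omega⟩, by simpa using hne, rfl⟩)

/-- The code is systematic, so the support of the output starts at time `0`; by burst recovery it
cannot end before time `B`. -/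
theorem lt_columnSpan_code (hAv : IsMDSParity Av) (hpos : 0 < Fintype.card (Src B K M)) :
    B + 1 ≤ (code Av Au).columnSpan (K + B) := by
  refine le_csInf ((ConvolutionalCode.nonempty_inputs hpos _).image _) ?_
  rintro _ ⟨s, hs, rfl⟩
  have h0 : (code Av Au).truncOutput (K + B) s 0 ≠ 0 := by
    intro h
    have h1 := out_extend_eq_zero Av Au h
    refine extend_zero hs (funext fun a => ?_)
    rw [← out_source Av Au (extend s) 0 a]
    simpa using congrFun h1 (.inl a)
  obtain ⟨j, hj, hjB⟩ : ∃ j : Fin (K + B + 1),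
      (code Av Au).truncOutput (K + B) s j ≠ 0 ∧ B ≤ (j : ℕ) := by
    by_contra! hall
    refine extend_zero hs (source_eq_zero_of_burst (Au := Au) hAv (extend_neg s) ?_)
    intro z h1 h2
    lift z to ℕ using by omega
    refine out_extend_eq_zero Av Au (i := ⟨z, by omega⟩) ?_
    by_contra hne
    have := hall _ hne
    simp only at this
    omega
  have := lt_symbolSpan h0 hj
  simp only [Fin.val_zero, tsub_zero] at this
  exact Nat.succ_le_of_lt (hjB.trans_lt this)

end StreamingCode

end

/-! ### The theorem -/

theorem proposition4 :
    (∀ (F : Type*) [Field F] [Finite F] (n k m : ℕ), 0 < k → k < n →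
      ∀ (C : ConvolutionalCode F n k m) (T : ℕ), 0 < T →
        codeRate n k / (1 - codeRate n k) * (C.columnSpan T : ℝ) + (C.columnDistance T : ℝ)
          ≤ (T : ℝ) + 1 + 1 / (1 - codeRate n k)) ∧
    (∀ T : ℕ, 0 < T → ∀ N B : ℕ, 1 ≤ N → N ≤ B → B ≤ T →
      ∃ n k m q₀ : ℕ, 0 < k ∧ k < n ∧
        codeRate n k / (1 - codeRate n k) * (B : ℝ) + (N : ℝ) > (T : ℝ) ∧
        ∀ (F : Type*) [Field F] [Finite F], q₀ ≤ Nat.card F →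
          ∃ C : ConvolutionalCode F n k m,
            N + 1 ≤ C.columnDistance T ∧ B + 1 ≤ C.columnSpan T ∧
            codeRate n k / (1 - codeRate n k) * (C.columnSpan T : ℝ) + (C.columnDistance T : ℝ)
              ≥ (T : ℝ) + 1 / (1 - codeRate n k)) := by
  refine ⟨fun F _ _ n k m hk hkn C T _ =>
    C.rate_mul_columnSpan_add_columnDistance_le hk hkn T, ?_⟩
  intro T _ N B hN hNB hBT
  obtain ⟨K, rfl⟩ : ∃ K, T = K + B := ⟨T - B, by omega⟩
  -- The largest `M` for which the urgent code, of length `M + N`, fits in the window of `T + 1`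
  -- symbols.
  obtain ⟨M, hM⟩ : ∃ M, M + N = K + B + 1 := ⟨K + B + 1 - N, by omega⟩
  have hkcard : Fintype.card (StreamingCode.Src B K M) = (K + B) * M := by
    simp only [Fintype.card_sum, Fintype.card_prod, Fintype.card_fin]
    ring
  have hncard : Fintype.card (StreamingCode.Chan B K M N) = (K + B) * M + B * (K + B + 1) := by
    rw [Fintype.card_sum, hkcard, ← hM]
    simp only [Fintype.card_sum, Fintype.card_prod, Fintype.card_fin]
    ring
  set k := Fintype.card (StreamingCode.Src B K M) with hk
  set n := Fintype.card (StreamingCode.Chan B K M N) with hn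
  have hkpos : 0 < k := by
    rw [hkcard]
    exact Nat.mul_pos (by omega) (by omega)
  have hdiff : 0 < B * (K + B + 1) := Nat.mul_pos (by omega) (by omega)
  have hkn : k < n := by omega
  have hnk : (0 : ℝ) < n - k := by
    rw [sub_pos]
    exact_mod_cast hkn
  have hn0 : (0 : ℝ) < n := by exact_mod_cast hkpos.trans hkn
  have h1R : 1 - codeRate n k = (n - k) / n := by
    unfold codeRate; field_simp
  have hR : codeRate n k / (1 - codeRate n k) = k / (n - k) := by
    rw [h1R]; unfold codeRate; field_simp
  have hR' : 1 / (1 - codeRate n k) = 1 + k / (n - k) := by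
    rw [h1R]; field_simp; ring
  have hrate : (k : ℝ) / (n - k) * B + N > ((K + B : ℕ) : ℝ) := by
    have hB : (0 : ℝ) < B := by exact_mod_cast hN.trans hNB
    have hM' : (M : ℝ) = K + B + 1 - N := by
      rw [eq_sub_iff_add_eq]
      exact_mod_cast hM
    have hN' : (0 : ℝ) < N := by exact_mod_cast hN
    have hT : (0 : ℝ) < K + B + 1 := by positivity
    -- Since `k / (n - k) = T M / (B (T + 1))`, the excess over `T` is exactly `N / (T + 1)`.
    have : (k : ℝ) / (n - k) * B + N = ((K + B : ℕ) : ℝ) + N / (K + B + 1) := by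
      rw [hncard, hkcard]
      push_cast
      rw [hM', add_sub_cancel_left]
      field_simp
      ring
    rw [this]
    exact lt_add_of_pos_right _ (div_pos hN' hT)
  -- The longer block code has length `M + N = K + B + 1` and needs that many evaluation points.
  refine ⟨n, k, K + B, K + B + 1, hkpos, hkn, by rwa [hR], fun F _ _ hF => ?_⟩
  obtain ⟨Av, hAv⟩ := exists_isMDSParity (F := F) K B (by omega)
  obtain ⟨Au, hAu⟩ := exists_isMDSParity (F := F) M N (by omega)
  have hd := StreamingCode.lt_columnDistance_code hAv hAu hNB hM.le hkpos
  have hc := StreamingCode.lt_columnSpan_code (Au := Au) hAv hkpos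
  refine ⟨StreamingCode.code Av Au, hd, hc, ?_⟩
  rw [hR, hR']
  have hd' : (N : ℝ) + 1 ≤ ((StreamingCode.code Av Au).columnDistance (K + B) : ℝ) := by
    exact_mod_cast hd
  have hc' : (B : ℝ) + 1 ≤ ((StreamingCode.code Av Au).columnSpan (K + B) : ℝ) := by
    exact_mod_cast hc
  have hmul := mul_le_mul_of_nonneg_left hc' (div_nonneg (Nat.cast_nonneg k) hnk.le)
  rw [mul_add, mul_one] at hmul
  linarith
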